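/- Fix constants $\tfrac12\le q\le q'<1$ and $c\in\mathbb N$. Call a finite undirected graph $H$ *$(p,q,q')$-recursively separable* if either $|V(H)|\le c$, or (i) there is $S\subseteq V(H)$ with $|S|\le\min\{p,(q'-q)|V(H)|\}$ such that every connected component of $H-S$ has at most $q|V(H)|$ vertices, and (ii) every proper subgraph of $H$ (not necessarily induced) is $(p,q,q')$-recursively separable. Two weightings $w,w'\in\mathbb R_{\ge0}^{E}$ of the same graph are *neighbouring* if they differ on at most one edge, and there by at most $1$. **Theorem.** For every $a>0$ there is a constant $C_a$, depending only on $a,q,q',c$, such that the following holds. Let $0<\varepsilon,\delta<1$, let $n\in\mathbb N$ and $p\ge1$ be integers, and let $G=([n],E)$ be a $(p,q,q')$-recursively separable graph. Then there is a randomized algorithm (a Markov kernel from weightings to output distributions) that takes a weighting $w\in\mathbb R_{\ge0}^{E}$ of $G$, outputs estimates $\{\widehat d(s,t)\}_{s,t\in[n]}$, is $(\varepsilon,\delta)$-differentially private with respect to neighbouring weightings, and satisfies, for every $w$ and every $a>0$, with probability at least $1-n^{-a}$, $$|\widehat d(s,t)-d_{G,w}(s,t)|\le C_a\,\frac{p\,\log^2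 n\,\log(n/\delta)}{\varepsilon}\qquad\text{for all } s,t\in[n],$$ where $d_{G,w}$ is the shortest-path distance ($\infty$ if $s,t$ are not connected, in which case the inequality means $\widehat d(s,t)=\infty$). -/

import Mathlib

open MeasureTheory ProbabilityTheory
open scoped NNReal ENNReal

namespace PrivateAPSD

/-- `H` has a balanced separator: a set `S` of its vertices with `|S| ≤ min {p, (q' - q)|V(H)|}`
such that every connected component of `H - S` has at most `q |V(H)|` vertices.
(If `q, q' < 1` and `H` is nonempty, then `|V(H) ∖ S| > q |V(H)|`, so that `H - S` automatically
has at least two connected components.) -/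
def HasBalancedSeparator {V : Type*} {G : SimpleGraph V} (p : ℕ) (q q' : ℝ)
    (H : G.Subgraph) : Prop :=
  ∃ S : Set V, S ⊆ H.verts ∧ S.ncard ≤ p ∧ (S.ncard : ℝ) ≤ (q' - q) * (H.verts.ncard : ℝ) ∧
    ∀ K : (H.deleteVerts S).coe.ConnectedComponent,
      (K.supp.ncard : ℝ) ≤ q * (H.verts.ncard : ℝ)

/-- Recursive separability of a (finite) subgraph `H` of an ambient graph: either `H` has at most
`c` vertices, or `H` has a balanced separator and every subgraph of `H` (other than `H`) is
recursively separable. The number `c` is the constant hidden in "`|V| = O(1)`". Subgraphs need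
not be induced. -/
inductive SubgraphRecSeparable {V : Type*} {G : SimpleGraph V} (c p : ℕ) (q q' : ℝ) :
    G.Subgraph → Prop
  | small (H : G.Subgraph) (hc : H.verts.ncard ≤ c) : SubgraphRecSeparable c p q q' H
  | step (H : G.Subgraph) (hsep : HasBalancedSeparator p q q' H)
      (hsub : ∀ H' : G.Subgraph, H' < H → SubgraphRecSeparable c p q q' H') :
      SubgraphRecSeparable c p q q' H

/-- A finite graph is `(p, q, q')`-recursively separable, where graphs with at most `c` vertices
count as graphs of constant size. -/
def RecSeparable {V : Type*} (c p : ℕ) (q q' : ℝ) (G : SimpleGraph V) : Prop :=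
  SubgraphRecSeparable c p q q' (⊤ : G.Subgraph)

/-- The total weight of a walk, edges counted with multiplicity. -/
def walkWeight {V : Type*} {G : SimpleGraph V} (w : G.edgeSet → ℝ≥0) :
    {s t : V} → G.Walk s t → ℝ≥0
  | _, _, .nil => 0
  | _, _, .cons h r => w ⟨s(_, _), h⟩ + walkWeight w r

/-- The shortest-path distance in the weighted graph `(G, w)`; it is `∞` when there is no path. -/
noncomputable def wdist {V : Type*} {G : SimpleGraph V} (w : G.edgeSet → ℝ≥0) (s t : V) : ℝ≥0∞ :=
  ⨅ r : G.Walk s t, (walkWeight w r : ℝ≥0∞)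

/-- Weight-level neighbours: two weightings of the same graph that differ on at most one edge,
and there by at most `1` (that is, `‖w - w'‖₀ ≤ 1` and `‖w - w'‖₁ ≤ 1`). -/
def Neighboring {V : Type*} {G : SimpleGraph V} (w w' : G.edgeSet → ℝ≥0) : Prop :=
  {e | w e ≠ w' e}.Subsingleton ∧ ∀ e, |(w e : ℝ) - (w' e : ℝ)| ≤ 1

/-- `(ε, δ)`-differential privacy of a randomized algorithm `M` (a kernel, giving the law of the
output for each input) with respect to a neighbouring relation on the inputs. -/
def IsDifferentiallyPrivate {X Y : Type*} [MeasurableSpace X] [MeasurableSpace Y]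
    (nbr : X → X → Prop) (ε δ : ℝ) (M : Kernel X Y) : Prop :=
  ∀ x x' : X, nbr x x' → ∀ T : Set Y, MeasurableSet T →
    M x T ≤ ENNReal.ofReal (Real.exp ε) * M x' T + ENNReal.ofReal δ

/-- The estimates `est` of all pairwise distances are within additive error `B`, that is,
`|est s t - d(s, t)| ≤ B`. Estimates are extended reals; for `s, t` not joined by a path
(`d(s, t) = ∞`) the two inequalities say exactly that `est s t = ∞`. -/
def WithinError {V : Type*} {G : SimpleGraph V} (w : G.edgeSet → ℝ≥0) (B : ℝ)
    (est : V → V → EReal) : Prop :=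
  ∀ s t : V, (wdist w s t : EReal) ≤ est s t + (B : EReal) ∧
    est s t ≤ (wdist w s t : EReal) + (B : EReal)

end PrivateAPSD

/-!
Separators are organised by a level function on the vertices. Level `0` is a balanced separator of
the graph, and each component that remains is treated in the same way, one level higher. As sizes
shrink by the factor `q < 1` at every level, `O(log n)` levels suffice (`exists_level`). A vertex
`x` is a *hub* of `a` if `a` can be reached from `x` without going below the level of `x`; every
vertex has at most `p + c` hubs per level, hence `P = O(p log n)` hubs in total.

The algorithm answers one distance query for every pair `(x, y)` such that `y` is a hub of `x`: the
length of a shortest walk from `x` to `y` whose edges all touch the piece of `x`, that is, the set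
of vertices of which `x` is a hub. Two facts make these shortcuts useful.

* They determine all distances by short chains (`meetDist_exactShortcut`). Split a walk at a vertex
  of least level, and cut each half, read towards that vertex, at every vertex whose level is below
  all earlier ones. Between two cuts the walk stays in the piece of the earlier cut vertex, and the
  later one is a hub of it. There are at most as many cuts as levels.
* A single edge touches few of them (`sum_shortcutVector_sub_sq_le`): `x` has to be a hub of an
  endpoint of the edge and `y` a hub of `x`, which leaves `2 P²` pairs. So the vector of all queries
  has Euclidean sensitivity `O(P)`.

By the Gaussian mechanism (`gaussian_mechanism`), noise of standard deviation
`O(P √(log (1/δ) + 1) / ε)` in each answer is private. With probability `1 - n⁻ᵃ` no noise term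
exceeds this by more than a factor `O(√(log n))`, and the errors add up along chains of `O(log n)`
shortcuts. The total is `O(p log² n √((log (1/δ) + 1) log n) / ε)`, and the square root is
`O(log (n/δ))`. The noise does not depend on `a`, which enters only through the tail bound.
-/

namespace PrivateAPSD

/-! ### The Gaussian mechanism -/

lemma lintegral_pi_prod {ι : Type*} [Fintype ι] (μ : ι → Measure ℝ)
    [∀ i, IsProbabilityMeasure (μ i)] (f : ι → ℝ → ℝ≥0∞) (hf : ∀ i, Measurable (f i)) :
    ∫⁻ x, ∏ i, f i (x i) ∂(Measure.pi μ) = ∏ i, ∫⁻ y, f i y ∂(μ i) := by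
  have hind : iIndepFun (fun i (x : ι → ℝ) => f i (x i)) (Measure.pi μ) :=
    iIndepFun_pi (X := f) (fun i => (hf i).aemeasurable)
  rw [lintegral_prod_eq_prod_lintegral_of_indepFun Finset.univ _ hind
    (fun i => (hf i).comp (measurable_pi_apply i))]
  refine Finset.prod_congr rfl fun i _ => ?_
  rw [← (measurePreserving_eval μ i).map_eq, lintegral_map (hf i) (measurable_pi_apply i)]

lemma pi_withDensity {ι : Type*} [Fintype ι] (μ : ι → Measure ℝ)
    [∀ i, IsProbabilityMeasure (μ i)] (f : ι → ℝ → ℝ≥0∞) (hf : ∀ i, Measurable (f i))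
    [∀ i, IsProbabilityMeasure ((μ i).withDensity (f i))] :
    Measure.pi (fun i => (μ i).withDensity (f i)) =
      (Measure.pi μ).withDensity (fun x => ∏ i, f i (x i)) := by
  refine (Measure.pi_eq fun s hs => ?_)
  rw [withDensity_apply _ (MeasurableSet.univ_pi hs),
    ← lintegral_indicator (MeasurableSet.univ_pi hs)]
  have : (Set.univ.pi s).indicator (fun x : ι → ℝ => ∏ i, f i (x i)) =
      fun x => ∏ i, (s i).indicator (f i) (x i) := by
    funext x
    by_cases hx : x ∈ Set.univ.pi s
    · rw [Set.indicator_of_mem hx]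
      exact Finset.prod_congr rfl fun i _ =>
        (Set.indicator_of_mem (hx i (Set.mem_univ i)) _).symm
    · rw [Set.indicator_of_notMem hx]
      obtain ⟨i, hi⟩ : ∃ i, x i ∉ s i := by simpa [Set.mem_pi] using hx
      exact (Finset.prod_eq_zero (Finset.mem_univ i) (Set.indicator_of_notMem hi _)).symm
  rw [this, lintegral_pi_prod μ _ fun i => (hf i).indicator (hs i)]
  exact Finset.prod_congr rfl fun i _ => by
    rw [lintegral_indicator (hs i), withDensity_apply _ (hs i)]

/-- Likelihood ratio of two Gaussian laws on `ℝ` of the same variance. -/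
lemma gaussianReal_add_eq_withDensity (m d : ℝ) {v : ℝ≥0} (hv : v ≠ 0) :
    gaussianReal (m + d) v = (gaussianReal m v).withDensity
      (fun x => ENNReal.ofReal (Real.exp (d * (x - m) / v - d ^ 2 / (2 * v)))) := by
  have hv' : (v : ℝ) ≠ 0 := by exact_mod_cast hv
  rw [gaussianReal_of_var_ne_zero _ hv, gaussianReal_of_var_ne_zero _ hv,
    ← withDensity_mul _ (measurable_gaussianPDF m v) (by fun_prop)]
  congr 1
  funext x
  simp only [Pi.mul_apply, gaussianPDF]
  rw [← ENNReal.ofReal_mul (gaussianPDFReal_nonneg _ _ _)]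
  congr 1
  simp only [gaussianPDFReal]
  rw [mul_assoc (√(2 * Real.pi * v))⁻¹, ← Real.exp_add]
  congr 2
  field_simp
  ring

/-- The moments of the likelihood ratio of two Gaussian laws of the same variance. -/
lemma lintegral_gaussian_ratio_rpow (m d l : ℝ) {v : ℝ≥0} (hv : v ≠ 0) :
    ∫⁻ x, ENNReal.ofReal (Real.exp ((1 + l) * (d * (x - m) / v - d ^ 2 / (2 * v))))
      ∂(gaussianReal m v) = ENNReal.ofReal (Real.exp (l * (1 + l) * (d ^ 2 / (2 * v)))) := by
  have hv' : (v : ℝ) ≠ 0 := by exact_mod_cast hv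
  -- Up to a constant factor the integrand is the density of the law with mean `m + (1 + l) d`.
  have h : ∀ x : ℝ, ENNReal.ofReal (Real.exp ((1 + l) * (d * (x - m) / v - d ^ 2 / (2 * v)))) =
      ENNReal.ofReal (Real.exp (l * (1 + l) * (d ^ 2 / (2 * v)))) *
        ENNReal.ofReal (Real.exp (((1 + l) * d) * (x - m) / v - ((1 + l) * d) ^ 2 / (2 * v))) := by
    intro x
    rw [← ENNReal.ofReal_mul (Real.exp_pos _).le, ← Real.exp_add]
    congr 2
    field_simp
    ring
  simp_rw [h]
  rw [lintegral_const_mul _ (by fun_prop), ← setLIntegral_univ,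
    ← withDensity_apply _ MeasurableSet.univ, ← gaussianReal_add_eq_withDensity _ _ hv]
  simp

/-- Privacy of Gaussian noise in terms of a moment of order `1 + l` of the likelihood ratio:
the excess `δ` is the Chernoff bound for the probability that the ratio exceeds `exp ε`. -/
lemma gaussian_shift_le {ι : Type*} [Fintype ι] (u u' : ι → ℝ) {v : ℝ≥0} (hv : v ≠ 0)
    (ε l : ℝ) (hl : 0 ≤ l) (T : Set (ι → ℝ)) (hT : MeasurableSet T) :
    Measure.pi (fun i => gaussianReal (u i) v) T ≤
      ENNReal.ofReal (Real.exp ε) * Measure.pi (fun i => gaussianReal (u' i) v) T +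
      ENNReal.ofReal (Real.exp (-(l * ε) + l * (1 + l) * ((∑ i, (u i - u' i) ^ 2) / (2 * v)))) := by
  set Q := Measure.pi (fun i => gaussianReal (u' i) v) with hQ
  let a : ι → ℝ → ℝ := fun i x => (u i - u' i) * (x - u' i) / v - (u i - u' i) ^ 2 / (2 * v)
  have ham : ∀ i, Measurable (a i) := fun i => by fun_prop
  let f : ι → ℝ → ℝ≥0∞ := fun i x => ENNReal.ofReal (Real.exp (a i x))
  have hfm : ∀ i, Measurable (f i) := fun i => by fun_prop
  have h1 : ∀ i, gaussianReal (u i) v = (gaussianReal (u' i) v).withDensity (f i) := fun i => by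
    have := gaussianReal_add_eq_withDensity (u' i) (u i - u' i) hv
    rwa [add_sub_cancel] at this
  have hprob : ∀ i, IsProbabilityMeasure ((gaussianReal (u' i) v).withDensity (f i)) :=
    fun i => by rw [← h1 i]; infer_instance
  simp_rw [h1]
  rw [pi_withDensity _ f hfm, withDensity_apply _ hT]
  have hprod : ∀ x : ι → ℝ, ∏ i, f i (x i) = ENNReal.ofReal (Real.exp (∑ i, a i (x i))) := by
    intro x
    rw [Real.exp_sum, ENNReal.ofReal_prod_of_nonneg fun i _ => (Real.exp_pos _).le]
  have hpt : ∀ x : ι → ℝ, ∏ i, f i (x i) ≤ ENNReal.ofReal (Real.exp ε) +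
      ENNReal.ofReal (Real.exp (-(l * ε))) *
        ∏ i, ENNReal.ofReal (Real.exp ((1 + l) * a i (x i))) := by
    intro x
    rw [hprod, ← ENNReal.ofReal_prod_of_nonneg fun i _ => (Real.exp_pos _).le, ← Real.exp_sum,
      ← Finset.mul_sum, ← ENNReal.ofReal_mul (Real.exp_pos _).le, ← Real.exp_add]
    rcases le_total (∑ i, a i (x i)) ε with h | h
    · exact le_add_right (ENNReal.ofReal_le_ofReal (Real.exp_le_exp.2 h))
    · refine le_add_left (ENNReal.ofReal_le_ofReal (Real.exp_le_exp.2 ?_))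
      nlinarith
  calc ∫⁻ x in T, ∏ i, f i (x i) ∂Q
      ≤ ∫⁻ x in T, (ENNReal.ofReal (Real.exp ε) + ENNReal.ofReal (Real.exp (-(l * ε))) *
        ∏ i, ENNReal.ofReal (Real.exp ((1 + l) * a i (x i)))) ∂Q := lintegral_mono hpt
    _ = ENNReal.ofReal (Real.exp ε) * Q T + ∫⁻ x in T, ENNReal.ofReal (Real.exp (-(l * ε))) *
        ∏ i, ENNReal.ofReal (Real.exp ((1 + l) * a i (x i))) ∂Q := by
      rw [lintegral_add_left measurable_const, setLIntegral_const]
    _ ≤ ENNReal.ofReal (Real.exp ε) * Q T + ∫⁻ x, ENNReal.ofReal (Real.exp (-(l * ε))) *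
        ∏ i, ENNReal.ofReal (Real.exp ((1 + l) * a i (x i))) ∂Q := by
      gcongr
      exact Measure.restrict_le_self
    _ = _ := by
      rw [lintegral_const_mul _ (by fun_prop),
        lintegral_pi_prod _ (fun i y => ENNReal.ofReal (Real.exp ((1 + l) * a i y)))
          (fun i => by fun_prop)]
      simp only [a]
      simp_rw [lintegral_gaussian_ratio_rpow _ _ _ hv]
      rw [← ENNReal.ofReal_prod_of_nonneg fun i _ => (Real.exp_pos _).le, ← Real.exp_sum,
        ← ENNReal.ofReal_mul (Real.exp_pos _).le, ← Real.exp_add, ← Finset.mul_sum,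
        Finset.sum_div]

/-- The **Gaussian mechanism**: noise of variance `4 (log (1/δ) + 1) Δ² / ε²` in every coordinate
hides a change of the mean of Euclidean length at most `Δ`. -/
lemma gaussian_mechanism {ι : Type*} [Fintype ι] (u u' : ι → ℝ) {ε δ Δ : ℝ} (hε : 0 < ε)
    (hε1 : ε < 1) (hδ : 0 < δ) (hδ1 : δ < 1) (hΔ : 0 < Δ) {v : ℝ≥0}
    (hv : (v : ℝ) = 4 * (Real.log (1 / δ) + 1) * Δ ^ 2 / ε ^ 2)
    (hu : ∑ i, (u i - u' i) ^ 2 ≤ Δ ^ 2) (T : Set (ι → ℝ)) (hT : MeasurableSet T) :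
    (Measure.pi fun _ : ι => gaussianReal 0 v) {z | (fun i => u i + z i) ∈ T} ≤
      ENNReal.ofReal (Real.exp ε) *
        (Measure.pi fun _ : ι => gaussianReal 0 v) {z | (fun i => u' i + z i) ∈ T} +
      ENNReal.ofReal δ := by
  set L := Real.log (1 / δ) + 1 with hL
  have hlog : 0 < Real.log (1 / δ) := Real.log_pos (by rw [lt_div_iff₀ hδ]; linarith)
  have hL1 : 1 ≤ L := by linarith
  have hvpos : (0 : ℝ) < v := by rw [hv]; positivity
  have hv0 : v ≠ 0 := by rintro rfl; simp at hvpos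
  have hshift : ∀ y : ι → ℝ, (Measure.pi fun _ : ι => gaussianReal 0 v)
      {z | (fun i => y i + z i) ∈ T} = Measure.pi (fun i => gaussianReal (y i) v) T := by
    intro y
    have : Measure.pi (fun i => gaussianReal (y i) v) =
        (Measure.pi fun _ : ι => gaussianReal 0 v).map (fun z i => y i + z i) := by
      have hm : ∀ i, IsProbabilityMeasure ((gaussianReal 0 v).map fun z => y i + z) := fun i =>
        Measure.isProbabilityMeasure_map (by fun_prop)
      rw [Measure.pi_map_pi (f := fun i z => y i + z) (fun i => by fun_prop)]
      simp_rw [gaussianReal_map_const_add, zero_add]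
    rw [this, Measure.map_apply (by fun_prop) hT]
    rfl
  rw [hshift, hshift]
  -- `l = 4 L / ε` makes the exponent at most `-2 L + 1/2 ≤ log δ`.
  refine (gaussian_shift_le u u' hv0 ε (4 * L / ε) (by positivity) T hT).trans ?_
  gcongr
  rw [← Real.exp_log hδ]
  refine Real.exp_le_exp.2 ?_
  have hlogδ : Real.log δ = 1 - L := by
    rw [hL, one_div, Real.log_inv]; ring
  have hfrac : (∑ i, (u i - u' i) ^ 2) / (2 * v) ≤ ε ^ 2 / (8 * L) := by
    rw [hv]
    calc _ ≤ Δ ^ 2 / (2 * (4 * L * Δ ^ 2 / ε ^ 2)) := by gcongr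
      _ = _ := by field_simp; norm_num
  calc -(4 * L / ε * ε) + 4 * L / ε * (1 + 4 * L / ε) * ((∑ i, (u i - u' i) ^ 2) / (2 * v))
      ≤ -(4 * L / ε * ε) + 4 * L / ε * (1 + 4 * L / ε) * (ε ^ 2 / (8 * L)) := by gcongr
    _ = -2 * L + ε / 2 := by field_simp; ring
    _ ≤ Real.log δ := by rw [hlogδ]; linarith

/-- Two-sided Gaussian tail bound. -/
lemma gaussianReal_abs_ge_le {v : ℝ≥0} (hv : v ≠ 0) {τ : ℝ} (hτ : 0 ≤ τ) :
    (gaussianReal 0 v).real {x | τ ≤ |x|} ≤ 2 * Real.exp (-τ ^ 2 / (2 * v)) := by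
  have hv' : (0 : ℝ) < v := by exact_mod_cast pos_iff_ne_zero.2 hv
  have hsub : HasSubgaussianMGF (fun x : ℝ => x) v (gaussianReal 0 v) := by
    refine ⟨fun t => integrable_exp_mul_gaussianReal t, fun t => ?_⟩
    rw [mgf_gaussianReal (μ := 0) (v := v) (by simp)]
    simp
  have h1 := hsub.measure_ge_le hτ
  have h2 := hsub.neg.measure_ge_le hτ
  have : {x : ℝ | τ ≤ |x|} ⊆ {x | τ ≤ x} ∪ {x | τ ≤ (-fun x : ℝ => x) x} := by
    intro x hx
    rcases le_abs.1 (show τ ≤ |x| from hx) with h | h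
    · exact Or.inl h
    · exact Or.inr h
  calc _ ≤ _ := measureReal_mono this
    _ ≤ _ := measureReal_union_le _ _
    _ ≤ _ := by linarith

/-- Union bound: with high probability no coordinate of Gaussian noise is large. -/
lemma gaussian_pi_tail {ι : Type*} [Fintype ι] {v : ℝ≥0} (hv : v ≠ 0) {τ : ℝ} (hτ : 0 ≤ τ) :
    1 - Fintype.card ι * (2 * Real.exp (-τ ^ 2 / (2 * v))) ≤
      (Measure.pi fun _ : ι => gaussianReal 0 v).real {z | ∀ i, |z i| ≤ τ} := by
  set μ := Measure.pi fun _ : ι => gaussianReal 0 v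
  have hms : MeasurableSet {z : ι → ℝ | ∀ i, |z i| ≤ τ} := by
    rw [Set.ofPred_forall]
    exact MeasurableSet.iInter fun i => measurableSet_le (by fun_prop) measurable_const
  have hc : μ.real {z : ι → ℝ | ∀ i, |z i| ≤ τ}ᶜ ≤
      Fintype.card ι * (2 * Real.exp (-τ ^ 2 / (2 * v))) := by
    have hsub : {z : ι → ℝ | ∀ i, |z i| ≤ τ}ᶜ ⊆ ⋃ i, {z | τ ≤ |z i|} := by
      intro z hz
      obtain ⟨i, hi⟩ : ∃ i, τ < |z i| := by simpa using hz
      exact Set.mem_iUnion.2 ⟨i, hi.le⟩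
    calc _ ≤ _ := measureReal_mono hsub
      _ ≤ ∑ i, μ.real {z | τ ≤ |z i|} := measureReal_iUnion_fintype_le _
      _ ≤ ∑ _i : ι, 2 * Real.exp (-τ ^ 2 / (2 * v)) := by
        refine Finset.sum_le_sum fun i _ => ?_
        have := (measurePreserving_eval (fun _ : ι => gaussianReal 0 v) i).measureReal_preimage
          (s := {x : ℝ | τ ≤ |x|})
          (measurableSet_le measurable_const (by fun_prop)).nullMeasurableSet
        exact this.le.trans (gaussianReal_abs_ge_le hv hτ)
      _ = _ := by simp
  have := probReal_compl_eq_one_sub (μ := μ) hms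
  linarith

/-! ### Level functions of recursively separable graphs -/

/-- `a` can be reached from `x` by a walk inside `A` that never goes below the level of `x`.
For fixed `x` these `a` form the piece of the recursive decomposition of `A` in which `x` is a
separator vertex; the vertex `x` is then a hub of all `a` in this piece. -/
def HubOf {V : Type*} (G : SimpleGraph V) (A : Set V) (lvl : V → ℕ) (x a : V) : Prop :=
  ∃ r : G.Walk x a, ∀ y ∈ r.support, y ∈ A ∧ lvl x ≤ lvl y

/-- The set of vertices that a walk inside `A` can reach from `a`. -/
def componentIn {V : Type*} (G : SimpleGraph V) (A : Set V) (a : V) : Set V :=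
  {b | ∃ r : G.Walk a b, ∀ y ∈ r.support, y ∈ A}

lemma componentIn_eq {V : Type*} {G : SimpleGraph V} {A : Set V} {a b : V}
    (h : b ∈ componentIn G A a) : componentIn G A b = componentIn G A a := by
  obtain ⟨r, hr⟩ := h
  ext x
  constructor
  · rintro ⟨r', hr'⟩
    refine ⟨r.append r', fun y hy => ?_⟩
    rcases SimpleGraph.Walk.mem_support_append_iff _ _ |>.1 hy with hy | hy
    exacts [hr y hy, hr' y hy]
  · rintro ⟨r', hr'⟩
    refine ⟨r.reverse.append r', fun y hy => ?_⟩
    rcases SimpleGraph.Walk.mem_support_append_iff _ _ |>.1 hy with hy | hy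
    exacts [hr y (by simpa using hy), hr' y hy]

lemma mem_componentIn_self {V : Type*} {G : SimpleGraph V} {A : Set V} {a : V} (ha : a ∈ A) :
    a ∈ componentIn G A a := ⟨.nil, by simpa using ha⟩

lemma componentIn_subset {V : Type*} {G : SimpleGraph V} {A : Set V} {a : V} :
    componentIn G A a ⊆ A := fun _ ⟨r, hr⟩ => hr _ r.end_mem_support

lemma mem_componentIn_of_walk {V : Type*} {G : SimpleGraph V} {A : Set V} {a b : V}
    (r : G.Walk a b) (hr : ∀ y ∈ r.support, y ∈ A) {y : V} (hy : y ∈ r.support) :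
    y ∈ componentIn G A a := by
  classical
  exact ⟨r.takeUntil y hy, fun z hz => hr z (r.support_takeUntil_subset_support hy hz)⟩

/-- Walks in `G` inside `A \ S` are walks in the graph induced on `A` minus `S`. -/
lemma reachable_deleteVerts {V : Type*} {G : SimpleGraph V} {A S : Set V} {a b : V}
    (r : G.Walk a b) (hr : ∀ y ∈ r.support, y ∈ A \ S)
    (ha : a ∈ (((⊤ : G.Subgraph).induce A).deleteVerts S).verts)
    (hb : b ∈ (((⊤ : G.Subgraph).induce A).deleteVerts S).verts) :
    (((⊤ : G.Subgraph).induce A).deleteVerts S).coe.Reachable ⟨a, ha⟩ ⟨b, hb⟩ := by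
  induction r with
  | nil => exact .rfl
  | @cons a c b hac r ih =>
    have h1 := hr a (by simp)
    have h2 := hr c (by simp)
    have hc : c ∈ (((⊤ : G.Subgraph).induce A).deleteVerts S).verts := by simpa using h2
    refine SimpleGraph.Reachable.trans (v := ⟨c, hc⟩) (SimpleGraph.Adj.reachable ?_)
      (ih (fun y hy => hr y (by simp [hy])) hc hb)
    simp [SimpleGraph.Subgraph.coe_adj, h1.1, h1.2,
      h2.1, h2.2, hac]

/-- A separable vertex set whose size is less than `q⁻ᴰ` has a level function with `D` levels,
for which every vertex has at most `p + c` hubs of each level: level `0` consists of the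
separator, and the components that remain are treated recursively. -/
lemma exists_level {V : Type*} [Finite V] {G : SimpleGraph V} {c p : ℕ} {q q' : ℝ}
    (hq0 : 0 < q) (hq1 : q < 1) (D : ℕ) :
    ∀ A : Set V, SubgraphRecSeparable c p q q' ((⊤ : G.Subgraph).induce A) →
      q ^ D * A.ncard < 1 →
      ∃ lvl : V → ℕ, (∀ a ∈ A, lvl a < D) ∧
        ∀ a ∈ A, ∀ k, {x | lvl x = k ∧ HubOf G A lvl x a}.ncard ≤ p + c := by
  classical
  induction D with
  | zero =>
    intro A _ hA
    have : A.ncard = 0 := by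
      by_contra h
      have : (1 : ℝ) ≤ A.ncard := by exact_mod_cast Nat.one_le_iff_ne_zero.2 h
      linarith
    have hA0 : A = ∅ := (Set.ncard_eq_zero).1 this
    subst hA0
    exact ⟨fun _ => 0, by simp, by simp⟩
  | succ D ih =>
    intro A hsep hA
    cases hsep with
    | small _ hc =>
      refine ⟨fun _ => 0, by simp, fun a _ k => ?_⟩
      refine (Set.ncard_le_ncard (t := A) ?_).trans (hc.trans (Nat.le_add_left _ _))
      rintro x ⟨-, r, hr⟩
      exact (hr x r.start_mem_support).1
    | step _ hS hsub =>
      obtain ⟨S, hSA, hSp, -, hK⟩ := hS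
      simp only [SimpleGraph.Subgraph.induce_verts] at hSA hK
      have hcomp : ∀ a ∈ A \ S, ((componentIn G (A \ S) a).ncard : ℝ) ≤ q * A.ncard := by
        intro a ha
        have hav : a ∈ (((⊤ : G.Subgraph).induce A).deleteVerts S).verts := by simpa using ha
        refine le_trans ?_ (hK ((((⊤ : G.Subgraph).induce A).deleteVerts S).coe.connectedComponentMk
          ⟨a, hav⟩))
        have : componentIn G (A \ S) a ⊆ Subtype.val ''
            ((((⊤ : G.Subgraph).induce A).deleteVerts S).coe.connectedComponentMk
              ⟨a, hav⟩).supp := by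
          intro b hb
          have hb' := componentIn_subset hb
          have hbv : b ∈ (((⊤ : G.Subgraph).induce A).deleteVerts S).verts := by simpa using hb'
          obtain ⟨r, hr⟩ := hb
          refine ⟨⟨b, hbv⟩, ?_, rfl⟩
          rw [SimpleGraph.ConnectedComponent.mem_supp_iff, SimpleGraph.ConnectedComponent.eq]
          exact (reachable_deleteVerts r hr hav hbv).symm
        exact_mod_cast (Set.ncard_le_ncard this).trans (Set.ncard_image_le (Set.toFinite _))
      have hrec : ∀ B : Set V, ∃ lvl : V → ℕ, (∃ a ∈ A \ S, B = componentIn G (A \ S) a) →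
          (∀ a ∈ B, lvl a < D) ∧
            ∀ a ∈ B, ∀ k, {x | lvl x = k ∧ HubOf G B lvl x a}.ncard ≤ p + c := by
        intro B
        by_cases hB : ∃ a ∈ A \ S, B = componentIn G (A \ S) a
        · obtain ⟨a, ha, hBa⟩ := hB
          have hcard := hcomp a ha
          rw [← hBa] at hcard
          have hApos : (0 : ℝ) < A.ncard := by
            exact_mod_cast (Set.ncard_pos (Set.toFinite A)).2 ⟨a, ha.1⟩
          have hBA : B ⊆ A := hBa ▸ componentIn_subset.trans Set.sdiff_subset
          have hlt : (⊤ : G.Subgraph).induce B < (⊤ : G.Subgraph).induce A := by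
            refine lt_of_le_of_ne (SimpleGraph.Subgraph.induce_mono_right hBA) fun h => ?_
            have : B = A := congrArg SimpleGraph.Subgraph.verts h
            rw [this] at hcard
            nlinarith
          obtain ⟨lvl, hlvl⟩ := ih B (hsub _ hlt) (by
            calc q ^ D * B.ncard ≤ q ^ D * (q * A.ncard) := by gcongr
              _ = q ^ (D + 1) * A.ncard := by ring
              _ < 1 := hA)
          exact ⟨lvl, fun _ => hlvl⟩
        · exact ⟨fun _ => 0, fun h => absurd h hB⟩
      choose L hL using hrec
      let lvl : V → ℕ := fun a => if a ∈ S then 0 else L (componentIn G (A \ S) a) a + 1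
      have hlvl0 : ∀ a, lvl a = 0 ↔ a ∈ S := fun a => by
        by_cases h : a ∈ S <;> simp [lvl, h]
      have hlvlB : ∀ a b, b ∈ componentIn G (A \ S) a →
          lvl b = L (componentIn G (A \ S) a) b + 1 := fun a b hb => by
        simp only [lvl]
        rw [if_neg (componentIn_subset hb).2, componentIn_eq hb]
      refine ⟨lvl, fun a ha => ?_, fun a ha k => ?_⟩
      · by_cases h : a ∈ S
        · rw [(hlvl0 a).2 h]; omega
        · have := (hL (componentIn G (A \ S) a) ⟨a, ⟨ha, h⟩, rfl⟩).1 a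
            (mem_componentIn_self ⟨ha, h⟩)
          rw [hlvlB a a (mem_componentIn_self ⟨ha, h⟩)]
          omega
      · rcases Nat.eq_zero_or_pos k with rfl | hk
        · refine (Set.ncard_le_ncard (t := S) ?_).trans (hSp.trans (Nat.le_add_right _ _))
          rintro x ⟨hx, -⟩
          exact (hlvl0 x).1 hx
        · by_cases h : a ∈ S
          · have : {x | lvl x = k ∧ HubOf G A lvl x a} = ∅ := by
              refine Set.eq_empty_iff_forall_notMem.2 ?_
              rintro x ⟨hx, r, hr⟩
              have := (hr a r.end_mem_support).2
              rw [(hlvl0 a).2 h] at this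
              omega
            simp [this]
          · set B := componentIn G (A \ S) a with hB
            have haB : a ∈ B := mem_componentIn_self ⟨ha, h⟩
            refine (Set.ncard_le_ncard ?_).trans ((hL B ⟨a, ⟨ha, h⟩, rfl⟩).2 a haB (k - 1))
            rintro x ⟨hx, r, hr⟩
            -- The walk stays at positive levels, hence within the component `B`.
            have hrS : ∀ y ∈ r.reverse.support, y ∈ A \ S := fun y hy => by
              have := hr y (by simpa using hy)
              refine ⟨this.1, fun hyS => ?_⟩
              rw [(hlvl0 y).2 hyS] at this
              omega
            have hrB : ∀ y ∈ r.support, y ∈ B := fun y hy =>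
              mem_componentIn_of_walk r.reverse hrS (by simpa using hy)
            have hxB := hlvlB a x (hrB x r.start_mem_support)
            refine ⟨by rw [← hB] at hxB; omega, r, fun y hy => ⟨hrB y hy, ?_⟩⟩
            have h1 := (hr y hy).2
            have h2 := hlvlB a y (hrB y hy)
            rw [← hB] at h2 hxB
            omega

/-- Number of hubs in all levels together. -/
lemma ncard_hubs_le {V : Type*} [Finite V] {G : SimpleGraph V} {A : Set V} {lvl : V → ℕ}
    {D P : ℕ} (hD : ∀ a ∈ A, lvl a < D)
    (hP : ∀ a ∈ A, ∀ k, {x | lvl x = k ∧ HubOf G A lvl x a}.ncard ≤ P) (a : V) (ha : a ∈ A) :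
    {x | HubOf G A lvl x a}.ncard ≤ D * P := by
  have : {x | HubOf G A lvl x a} ⊆
      ⋃ k ∈ Finset.range D, {x | lvl x = k ∧ HubOf G A lvl x a} := by
    rintro x ⟨r, hr⟩
    exact Set.mem_iUnion₂.2 ⟨lvl x, Finset.mem_range.2 (hD x (hr x r.start_mem_support).1),
      rfl, r, hr⟩
  calc _ ≤ _ := Set.ncard_le_ncard this
    _ ≤ ∑ k ∈ Finset.range D, {x | lvl x = k ∧ HubOf G A lvl x a}.ncard :=
      Finset.set_ncard_biUnion_le _ _
    _ ≤ ∑ _k ∈ Finset.range D, P := Finset.sum_le_sum fun k _ => hP a ha k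
    _ = D * P := by simp

/-! ### Weights of walks and restricted distances -/

section Walks

variable {V : Type*} {G : SimpleGraph V}

lemma walkWeight_append (w : G.edgeSet → ℝ≥0) {s t u : V} (r : G.Walk s t) (r' : G.Walk t u) :
    walkWeight w (r.append r') = walkWeight w r + walkWeight w r' := by
  induction r with
  | nil => simp [walkWeight]
  | cons h r ih => simp [walkWeight, ih, add_assoc]

lemma walkWeight_concat (w : G.edgeSet → ℝ≥0) {s t u : V} (r : G.Walk s t) (h : G.Adj t u) :
    walkWeight w (r.concat h) = walkWeight w r + w ⟨s(t, u), h⟩ := by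
  rw [SimpleGraph.Walk.concat_eq_append, walkWeight_append]
  simp [walkWeight]

lemma walkWeight_reverse (w : G.edgeSet → ℝ≥0) {s t : V} (r : G.Walk s t) :
    walkWeight w r.reverse = walkWeight w r := by
  induction r with
  | nil => rfl
  | @cons a b c h r ih =>
    rw [SimpleGraph.Walk.reverse_cons, walkWeight_append, ih]
    have : (⟨s(b, a), h.symm⟩ : G.edgeSet) = ⟨s(a, b), h⟩ := Subtype.ext Sym2.eq_swap
    simp [walkWeight, this, add_comm]

lemma walkWeight_dropUntil_le [DecidableEq V] (w : G.edgeSet → ℝ≥0) {s t u : V} (r : G.Walk s t)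
    (hu : u ∈ r.support) : walkWeight w (r.dropUntil u hu) ≤ walkWeight w r := by
  conv_rhs => rw [← r.take_spec hu, walkWeight_append]
  exact le_add_self

lemma walkWeight_bypass_le [DecidableEq V] (w : G.edgeSet → ℝ≥0) {s t : V} (r : G.Walk s t) :
    walkWeight w r.bypass ≤ walkWeight w r := by
  induction r with
  | nil => exact le_rfl
  | cons h r ih =>
    rw [SimpleGraph.Walk.bypass]
    split_ifs with hs
    · exact (walkWeight_dropUntil_le w _ hs).trans (ih.trans le_add_self)
    · simpa [walkWeight] using ih

lemma walkWeight_congr {w w' : G.edgeSet → ℝ≥0} {s t : V} (r : G.Walk s t)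
    (h : ∀ e : G.edgeSet, (e : Sym2 V) ∈ r.edges → w e = w' e) :
    walkWeight w r = walkWeight w' r := by
  induction r with
  | nil => rfl
  | cons ha r ih =>
    simp only [walkWeight]
    rw [h ⟨_, ha⟩ (by simp), ih fun e he => h e (by simp [he])]

lemma Neighboring.symm {w w' : G.edgeSet → ℝ≥0} (h : Neighboring w w') : Neighboring w' w :=
  ⟨by simpa only [ne_comm] using h.1, fun e => by rw [abs_sub_comm]; exact h.2 e⟩

/-- A walk without repeated edges uses the modified edge at most once. -/
lemma walkWeight_le_add_one {w w' : G.edgeSet → ℝ≥0} (hw : Neighboring w w') {s t : V}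
    (r : G.Walk s t) (hr : r.edges.Nodup) : walkWeight w r ≤ walkWeight w' r + 1 := by
  induction r with
  | nil => simp [walkWeight]
  | @cons a b c ha r ih =>
    simp only [SimpleGraph.Walk.edges_cons, List.nodup_cons] at hr
    simp only [walkWeight]
    by_cases he : w ⟨s(a, b), ha⟩ = w' ⟨s(a, b), ha⟩
    · rw [he, add_assoc]
      exact add_le_add_right (ih hr.2) _
    · have hrest : walkWeight w r = walkWeight w' r := by
        refine walkWeight_congr r fun e her => ?_
        by_contra hne
        have := hw.1 (show e ∈ {e | w e ≠ w' e} from hne) he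
        rw [this] at her
        exact hr.1 her
      have h1 : w ⟨s(a, b), ha⟩ ≤ w' ⟨s(a, b), ha⟩ + 1 := by
        have := (abs_le.1 (hw.2 ⟨s(a, b), ha⟩)).2
        rw [← NNReal.coe_le_coe]
        push_cast
        linarith
      rw [hrest, add_right_comm]
      exact add_le_add_left h1 _

lemma wdist_triangle (w : G.edgeSet → ℝ≥0) (s t u : V) :
    wdist w s u ≤ wdist w s t + wdist w t u := by
  simp only [wdist]
  refine ENNReal.le_iInf_add_iInf fun r r' => ?_
  refine (iInf_le _ (r.append r')).trans ?_
  rw [walkWeight_append, ENNReal.coe_add]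

lemma wdist_comm (w : G.edgeSet → ℝ≥0) (s t : V) : wdist w s t = wdist w t s := by
  apply le_antisymm <;>
  exact le_iInf fun r => (iInf_le _ r.reverse).trans (by rw [walkWeight_reverse])

/-- The shortest-path distance by walks all of whose edges lie in `F`. -/
noncomputable def restrictedDist (F : Set (Sym2 V)) (w : G.edgeSet → ℝ≥0) (s t : V) : ℝ≥0∞ :=
  ⨅ r : {r : G.Walk s t // ∀ e ∈ r.edges, e ∈ F}, (walkWeight w r.1 : ℝ≥0∞)

lemma wdist_le_restrictedDist (F : Set (Sym2 V)) (w : G.edgeSet → ℝ≥0) (s t : V) :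
    wdist w s t ≤ restrictedDist F w s t :=
  le_iInf fun r => iInf_le _ r.1

lemma restrictedDist_le {F : Set (Sym2 V)} (w : G.edgeSet → ℝ≥0) {s t : V} (r : G.Walk s t)
    (hr : ∀ e ∈ r.edges, e ∈ F) : restrictedDist F w s t ≤ walkWeight w r :=
  iInf_le (fun r : {r : G.Walk s t // ∀ e ∈ r.edges, e ∈ F} => (walkWeight w r.1 : ℝ≥0∞)) ⟨r, hr⟩

lemma restrictedDist_ne_top {F : Set (Sym2 V)} (w : G.edgeSet → ℝ≥0) {s t : V}
    (h : ∃ r : G.Walk s t, ∀ e ∈ r.edges, e ∈ F) : restrictedDist F w s t ≠ ⊤ := by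
  obtain ⟨r, hr⟩ := h
  exact ne_top_of_le_ne_top ENNReal.coe_ne_top (restrictedDist_le w r hr)

lemma restrictedDist_congr {F : Set (Sym2 V)} {w w' : G.edgeSet → ℝ≥0}
    (h : ∀ e : G.edgeSet, (e : Sym2 V) ∈ F → w e = w' e) (s t : V) :
    restrictedDist F w s t = restrictedDist F w' s t := by
  refine iInf_congr fun r => ?_
  rw [walkWeight_congr r.1 fun e he => h e (r.2 _ he)]

/-- The sensitivity of a distance is `1`, because an optimal walk can be taken to be a path. -/
lemma restrictedDist_le_add_one (F : Set (Sym2 V)) {w w' : G.edgeSet → ℝ≥0}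
    (hw : Neighboring w w') (s t : V) :
    restrictedDist F w s t ≤ restrictedDist F w' s t + 1 := by
  classical
  conv_rhs => rw [restrictedDist, ENNReal.iInf_add]
  refine le_iInf fun r => ?_
  refine (restrictedDist_le w r.1.bypass
    fun e he => r.2 e (r.1.edges_bypass_subset_edges he)).trans ?_
  have h := (walkWeight_le_add_one hw r.1.bypass r.1.bypass_isPath.isTrail.edges_nodup).trans
    (add_le_add_left (walkWeight_bypass_le w' r.1) 1)
  exact_mod_cast h

lemma measurable_restrictedDist [Countable V] (F : Set (Sym2 V)) (s t : V) :
    Measurable fun w : G.edgeSet → ℝ≥0 => restrictedDist F w s t := by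
  have : Countable (G.Walk s t) :=
    Function.Injective.countable (f := fun r : G.Walk s t => r.support)
      fun _ _ h => SimpleGraph.Walk.ext_support h
  have hw : ∀ {a b : V} (r : G.Walk a b), Measurable fun w : G.edgeSet → ℝ≥0 => walkWeight w r := by
    intro a b r
    induction r with
    | nil => exact measurable_const
    | cons h r ih => exact (measurable_pi_apply _).add ih
  exact Measurable.iInf fun r => (hw r.1).coe_nnreal_ennreal

end Walks

/-! ### Distances by chains of bounded length -/

/-- The least total length of a chain of at most `k` steps from `s` to `t`, where a step from `x`
to `y` has length `e x y`. -/
noncomputable def hopDist {V : Type*} [DecidableEq V] (e : V → V → ℝ≥0∞) : ℕ → V → V → ℝ≥0∞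
  | 0, s, t => if s = t then 0 else ⊤
  | k + 1, s, t => min (hopDist e k s t) (⨅ z, e s z + hopDist e k z t)

/-- The least total length of a chain from `s` to some vertex `m` and a chain from `t` to `m`,
each of at most `k` steps. -/
noncomputable def meetDist {V : Type*} [DecidableEq V] (e : V → V → ℝ≥0∞) (k : ℕ) (s t : V) :
    ℝ≥0∞ :=
  ⨅ m, hopDist e k s m + hopDist e k t m

section Hops

variable {V : Type*} [DecidableEq V]

lemma hopDist_antitone (e : V → V → ℝ≥0∞) (s t : V) : Antitone fun k => hopDist e k s t :=
  antitone_nat_of_succ_le fun _ => min_le_left _ _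

lemma hopDist_succ_le (e : V → V → ℝ≥0∞) (k : ℕ) (s z t : V) :
    hopDist e (k + 1) s t ≤ e s z + hopDist e k z t :=
  (min_le_right _ _).trans (iInf_le _ z)

lemma hopDist_le_add {e e' : V → V → ℝ≥0∞} {τ : ℝ≥0∞} (h : ∀ x y, e x y ≤ e' x y + τ) (k : ℕ)
    (s t : V) : hopDist e k s t ≤ hopDist e' k s t + k * τ := by
  induction k generalizing s with
  | zero => simp [hopDist]
  | succ k ih =>
    have hk : ((k + 1 : ℕ) : ℝ≥0∞) * τ = k * τ + τ := by push_cast; ring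
    conv_rhs => rw [hopDist, min_add, ENNReal.iInf_add]
    refine le_min ?_ (le_iInf fun z => ?_)
    · refine (min_le_left _ _).trans ((ih s).trans ?_)
      rw [hk]
      exact add_le_add_right le_self_add _
    · refine (hopDist_succ_le e k s z t).trans ((add_le_add (h s z) (ih z)).trans_eq ?_)
      rw [hk]
      ring

lemma meetDist_le_add {e e' : V → V → ℝ≥0∞} {τ : ℝ≥0∞} (h : ∀ x y, e x y ≤ e' x y + τ) (k : ℕ)
    (s t : V) : meetDist e k s t ≤ meetDist e' k s t + 2 * k * τ := by
  conv_rhs => rw [meetDist, ENNReal.iInf_add]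
  refine le_iInf fun m => (iInf_le _ m).trans ?_
  refine (add_le_add (hopDist_le_add h k s m) (hopDist_le_add h k t m)).trans_eq ?_
  ring

lemma wdist_le_hopDist {G : SimpleGraph V} (w : G.edgeSet → ℝ≥0) {e : V → V → ℝ≥0∞}
    (h : ∀ x y, wdist w x y ≤ e x y) (k : ℕ) (s t : V) : wdist w s t ≤ hopDist e k s t := by
  induction k generalizing s with
  | zero =>
    simp only [hopDist]
    split_ifs with hst
    · subst hst
      exact (iInf_le _ .nil).trans (by simp [walkWeight])
    · exact le_top
  | succ k ih =>
    exact le_min (ih s) (le_iInf fun z =>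
      (wdist_triangle w s z t).trans (add_le_add (h s z) (ih z)))

lemma measurable_hopDist [Countable V] {Ω : Type*} [MeasurableSpace Ω] {e : Ω → V → V → ℝ≥0∞}
    (he : ∀ x y, Measurable fun z => e z x y) (k : ℕ) (s t : V) :
    Measurable fun z => hopDist (e z) k s t := by
  induction k generalizing s with
  | zero => exact measurable_const
  | succ k ih =>
    exact (ih s).min (Measurable.iInf fun m => (he s m).add (ih m))

lemma measurable_meetDist [Countable V] {Ω : Type*} [MeasurableSpace Ω] {e : Ω → V → V → ℝ≥0∞}
    (he : ∀ x y, Measurable fun z => e z x y) (k : ℕ) (s t : V) :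
    Measurable fun z => meetDist (e z) k s t :=
  Measurable.iInf fun m => (measurable_hopDist he k s m).add (measurable_hopDist he k t m)

end Hops

/-! ### Shortcuts from vertices to their hubs -/

section Shortcuts

variable {V : Type*} {G : SimpleGraph V} {lvl : V → ℕ}

/-- The edges with an endpoint in the piece of the decomposition that belongs to `x`. -/
def hubEdges (G : SimpleGraph V) (lvl : V → ℕ) (x : V) : Set (Sym2 V) :=
  {e | ∃ a ∈ e, HubOf G Set.univ lvl x a}

/-- The pairs `(x, y)` that get a shortcut: `y` is a hub of `x`, and `y` can be reached from `x`
by edges in `hubEdges G lvl x`. This does not depend on the weights. -/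
def IsShortcut (G : SimpleGraph V) (lvl : V → ℕ) (x y : V) : Prop :=
  HubOf G Set.univ lvl y x ∧ ∃ r : G.Walk x y, ∀ e ∈ r.edges, e ∈ hubEdges G lvl x

/-- The matrix of lengths of shortcuts, `∞` where there is none. -/
noncomputable def shortcutMatrix (G : SimpleGraph V) (lvl : V → ℕ) (f : V → V → ℝ≥0∞)
    (x y : V) : ℝ≥0∞ :=
  open Classical in if IsShortcut G lvl x y then f x y else ⊤

/-- The exact lengths of the shortcuts. -/
noncomputable def exactShortcut (G : SimpleGraph V) (lvl : V → ℕ) (w : G.edgeSet → ℝ≥0) :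
    V → V → ℝ≥0∞ :=
  shortcutMatrix G lvl fun x y => restrictedDist (hubEdges G lvl x) w x y

/-- The exact lengths of the shortcuts as a vector of real numbers; the entries of pairs that are
not shortcuts are set to `0` and never used. -/
noncomputable def shortcutVector (G : SimpleGraph V) (lvl : V → ℕ) (w : G.edgeSet → ℝ≥0)
    (i : V × V) : ℝ :=
  open Classical in
  if IsShortcut G lvl i.1 i.2 then (restrictedDist (hubEdges G lvl i.1) w i.1 i.2).toReal else 0

lemma HubOf.symm {x y : V} (h : HubOf G Set.univ lvl x y) (hxy : lvl y ≤ lvl x) :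
    HubOf G Set.univ lvl y x := by
  obtain ⟨r, hr⟩ := h
  exact ⟨r.reverse, fun z hz => ⟨trivial, hxy.trans (hr z (by simpa using hz)).2⟩⟩

/-- A neighbour `z` of the piece of `x`, at most as high as `x`, is a hub of `x`. -/
lemma HubOf.of_adj {x y z : V} (h : HubOf G Set.univ lvl x y) (hyz : G.Adj y z)
    (hz : lvl z ≤ lvl x) : HubOf G Set.univ lvl z x := by
  obtain ⟨r, hr⟩ := h
  refine ⟨.cons hyz.symm r.reverse, fun u hu => ⟨trivial, ?_⟩⟩
  rcases List.mem_cons.1 (SimpleGraph.Walk.support_cons _ _ ▸ hu) with rfl | hu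
  · exact le_rfl
  · exact hz.trans (hr u (by simpa using hu)).2

lemma HubOf.adj {x y z : V} (h : HubOf G Set.univ lvl x y) (hyz : G.Adj y z)
    (hz : lvl x ≤ lvl z) : HubOf G Set.univ lvl x z := by
  obtain ⟨r, hr⟩ := h
  refine ⟨r.concat hyz, fun u hu => ⟨trivial, ?_⟩⟩
  simp only [SimpleGraph.Walk.support_concat, List.mem_append, List.mem_singleton] at hu
  rcases hu with hu | rfl
  exacts [(hr u hu).2, hz]

lemma exactShortcut_le (w : G.edgeSet → ℝ≥0) {x y : V} (h : HubOf G Set.univ lvl y x)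
    (r : G.Walk x y) (hr : ∀ e ∈ r.edges, e ∈ hubEdges G lvl x) :
    exactShortcut G lvl w x y ≤ walkWeight w r := by
  rw [exactShortcut, shortcutMatrix, if_pos ⟨h, r, hr⟩]
  exact restrictedDist_le w r hr

lemma wdist_le_exactShortcut (w : G.edgeSet → ℝ≥0) (x y : V) :
    wdist w x y ≤ exactShortcut G lvl w x y := by
  rw [exactShortcut, shortcutMatrix]
  split_ifs
  exacts [wdist_le_restrictedDist _ _ _ _, le_top]

/-- A walk that ends at a vertex of least level is covered by a chain of shortcuts: cut it at
every vertex whose level is below all earlier ones. In the induction `r₁` is the part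
already read since the last cut `s`, and `r` is the part still to be read. -/
lemma hopDist_exactShortcut_le [DecidableEq V] (w : G.edgeSet → ℝ≥0) {u z : V} (r : G.Walk u z)
    (hr : ∀ y ∈ r.support, lvl z ≤ lvl y) (s : V) (hs : lvl z ≤ lvl s) (r₁ : G.Walk s u)
    (h₁ : ∀ e ∈ r₁.edges, e ∈ hubEdges G lvl s) (hu : HubOf G Set.univ lvl s u) (k : ℕ)
    (hk : lvl s + 1 ≤ lvl z + k) :
    hopDist (exactShortcut G lvl w) k s z ≤ walkWeight w r₁ + walkWeight w r := by
  induction r generalizing s k with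
  | @nil z =>
    obtain ⟨k, rfl⟩ : ∃ j, k = j + 1 := ⟨k - 1, by omega⟩
    have hsz : lvl s ≤ lvl z := by
      obtain ⟨r, hr⟩ := hu
      exact (hr z r.end_mem_support).2
    refine (hopDist_antitone _ s z (show 1 ≤ k + 1 by omega)).trans ?_
    refine (hopDist_succ_le _ 0 s z z).trans ?_
    simpa [hopDist, walkWeight] using exactShortcut_le w (hu.symm hs) r₁ h₁
  | @cons u v z hadj r ih =>
    have hr' : ∀ y ∈ r.support, lvl z ≤ lvl y := fun y hy => hr y (by simp [hy])
    have h₂ : ∀ e ∈ (r₁.concat hadj).edges, e ∈ hubEdges G lvl s := by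
      intro e he
      simp only [SimpleGraph.Walk.edges_concat, List.concat_eq_append, List.mem_append, List.mem_singleton] at he
      rcases he with he | rfl
      exacts [h₁ e he, ⟨u, by simp, hu⟩]
    by_cases hv : lvl s ≤ lvl v
    · refine (ih hr' s hs (r₁.concat hadj) h₂ (hu.adj hadj hv) k hk).trans_eq ?_
      rw [walkWeight_concat]
      simp [walkWeight, add_assoc]
    · rw [not_le] at hv
      have hzv : lvl z ≤ lvl v := hr v (by simp)
      obtain ⟨k, rfl⟩ : ∃ j, k = j + 1 := ⟨k - 1, by omega⟩
      refine (hopDist_succ_le _ k s v z).trans ?_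
      refine (add_le_add (exactShortcut_le w (hu.of_adj hadj hv.le) _ h₂)
        (ih hr' v hzv .nil (by simp) ⟨.nil, by simp⟩ k (by omega))).trans_eq ?_
      rw [walkWeight_concat]
      simp [walkWeight, add_assoc]

/-- Shortcuts determine all distances, by chains whose number of steps is at most twice the
number of levels: split a walk at a vertex of least level. -/
lemma meetDist_exactShortcut [DecidableEq V] (w : G.edgeSet → ℝ≥0) {D : ℕ} (hD : ∀ a, lvl a < D)
    (s t : V) : meetDist (exactShortcut G lvl w) D s t = wdist w s t := by
  apply le_antisymm
  · refine le_iInf fun r => ?_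
    obtain ⟨m, hm, hmin⟩ := r.support.toFinset.exists_min_image lvl ⟨s, by simp⟩
    simp only [List.mem_toFinset] at hm hmin
    refine (iInf_le _ m).trans ?_
    have hself : ∀ x, HubOf G Set.univ lvl x x := fun x => ⟨.nil, by simp⟩
    have h1 := hopDist_exactShortcut_le w (r.takeUntil m hm)
      (fun y hy => hmin y (r.support_takeUntil_subset_support hm hy)) s (hmin s (by simp)) .nil
      (by simp) (hself s) D (by have := hD s; omega)
    have h2 := hopDist_exactShortcut_le w (r.dropUntil m hm).reverse
      (fun y hy => hmin y (r.support_dropUntil_subset_support hm (by simpa using hy))) t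
      (hmin t (by simp)) .nil (by simp) (hself t) D (by have := hD t; omega)
    refine (add_le_add h1 h2).trans_eq ?_
    conv_rhs => rw [← r.take_spec hm, walkWeight_append]
    simp [walkWeight, walkWeight_reverse]
  · refine le_iInf fun m => (wdist_triangle w s m t).trans ?_
    rw [wdist_comm w m t]
    exact add_le_add (wdist_le_hopDist w (wdist_le_exactShortcut w) _ _ _)
      (wdist_le_hopDist w (wdist_le_exactShortcut w) _ _ _)

lemma measurable_shortcutVector [Countable V] :
    Measurable (shortcutVector G lvl) := by
  refine measurable_pi_lambda _ fun i => ?_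
  simp only [shortcutVector]
  split_ifs
  exacts [(measurable_restrictedDist _ _ _).ennreal_toReal, measurable_const]

/-- A change of one edge weight affects only the shortcuts `(x, y)` for which `x` is a hub of an
endpoint of this edge and `y` is a hub of `x`, hence at most `2 P²` of them. -/
lemma sum_shortcutVector_sub_sq_le [Fintype V] {P : ℕ}
    (hP : ∀ a, {x | HubOf G Set.univ lvl x a}.ncard ≤ P) {w w' : G.edgeSet → ℝ≥0}
    (hw : Neighboring w w') :
    ∑ i, (shortcutVector G lvl w i - shortcutVector G lvl w' i) ^ 2 ≤ 2 * (P : ℝ) ^ 2 := by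
  classical
  by_cases hex : ∃ e, w e ≠ w' e
  swap
  · have : w = w' := funext fun e => by_contra fun h => hex ⟨e, h⟩
    subst this
    simp only [sub_self]
    simp
  obtain ⟨⟨e, he⟩, hne⟩ := hex
  induction e using Sym2.ind with
  | _ a b =>
  let T : Finset V := {x | HubOf G Set.univ lvl x a ∨ HubOf G Set.univ lvl x b}
  let Y : V → Finset V := fun x => {y | HubOf G Set.univ lvl y x}
  have hcard : ∀ c, (Finset.univ.filter fun x => HubOf G Set.univ lvl x c).card ≤ P := fun c => by
    rw [← Set.ncard_coe_finset]
    simpa using hP c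
  have hT : T.card ≤ 2 * P := by
    simp only [T]
    rw [Finset.filter_or]
    have := Finset.card_union_le (Finset.univ.filter fun x => HubOf G Set.univ lvl x a)
      (Finset.univ.filter fun x => HubOf G Set.univ lvl x b)
    have h1 := hcard a
    have h2 := hcard b
    omega
  have hterm : ∀ x y, (shortcutVector G lvl w (x, y) - shortcutVector G lvl w' (x, y)) ^ 2 ≤
      if x ∈ T then (if y ∈ Y x then (1 : ℝ) else 0) else 0 := by
    intro x y
    have hnn : (0 : ℝ) ≤ if x ∈ T then (if y ∈ Y x then (1 : ℝ) else 0) else 0 := by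
      split_ifs <;> norm_num
    by_cases hS : IsShortcut G lvl x y
    swap
    · simpa [shortcutVector, hS] using hnn
    by_cases hx : x ∈ T
    · have hy : y ∈ Y x := by simpa [Y] using hS.1
      rw [if_pos hx, if_pos hy, sq_le_one_iff_abs_le_one]
      simp only [shortcutVector, if_pos hS]
      have hw1 := restrictedDist_ne_top w hS.2
      have hw2 := restrictedDist_ne_top w' hS.2
      have h1 := ENNReal.toReal_mono (by simp [hw2])
        (restrictedDist_le_add_one (hubEdges G lvl x) hw x y)
      have h2 := ENNReal.toReal_mono (by simp [hw1])
        (restrictedDist_le_add_one (hubEdges G lvl x) hw.symm x y)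
      rw [ENNReal.toReal_add hw2 ENNReal.one_ne_top, ENNReal.toReal_one] at h1
      rw [ENNReal.toReal_add hw1 ENNReal.one_ne_top, ENNReal.toReal_one] at h2
      rw [abs_le]
      constructor <;> linarith
    · have : restrictedDist (hubEdges G lvl x) w x y = restrictedDist (hubEdges G lvl x) w' x y := by
        refine restrictedDist_congr (fun e' he' => ?_) x y
        by_contra h
        have := hw.1 (show e' ∈ {e | w e ≠ w' e} from h) hne
        subst this
        obtain ⟨c, hc, hxc⟩ := he'
        refine hx ?_
        simp only [T, Finset.mem_filter, Finset.mem_univ, true_and]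
        rcases Sym2.mem_iff.1 hc with rfl | rfl
        exacts [Or.inl hxc, Or.inr hxc]
      simpa [shortcutVector, hS, this] using hnn
  calc ∑ i, (shortcutVector G lvl w i - shortcutVector G lvl w' i) ^ 2
      = ∑ x, ∑ y, (shortcutVector G lvl w (x, y) - shortcutVector G lvl w' (x, y)) ^ 2 :=
        Fintype.sum_prod_type _
    _ ≤ ∑ x, ∑ y, if x ∈ T then (if y ∈ Y x then (1 : ℝ) else 0) else 0 :=
        Finset.sum_le_sum fun x _ => Finset.sum_le_sum fun y _ => hterm x y
    _ = ∑ x ∈ T, ((Y x).card : ℝ) := by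
        rw [← Finset.sum_filter_add_sum_filter_not Finset.univ (· ∈ T)]
        rw [Finset.sum_eq_zero (s := Finset.univ.filter fun x => x ∉ T), add_zero]
        · rw [Finset.filter_mem_eq_inter, Finset.univ_inter]
          refine Finset.sum_congr rfl fun x hx => ?_
          simp [hx]
        · intro x hx
          simp [(Finset.mem_filter.1 hx).2]
    _ ≤ ∑ _x ∈ T, (P : ℝ) := Finset.sum_le_sum fun x _ => by exact_mod_cast hcard x
    _ = T.card * (P : ℝ) := by simp
    _ ≤ (2 * P : ℕ) * (P : ℝ) := by gcongr
    _ = 2 * (P : ℝ) ^ 2 := by push_cast; ring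

/-- The estimates computed from noisy lengths of shortcuts. Negative lengths are rounded up
to `0`. -/
noncomputable def estimate [DecidableEq V] (G : SimpleGraph V) (lvl : V → ℕ) (D : ℕ)
    (z : V × V → ℝ) (s t : V) : EReal :=
  meetDist (shortcutMatrix G lvl fun x y => ENNReal.ofReal (z (x, y))) D s t

lemma measurable_estimate [DecidableEq V] [Countable V] (D : ℕ) :
    Measurable (estimate G lvl D) := by
  refine measurable_pi_lambda _ fun s => measurable_pi_lambda _ fun t => ?_
  refine Measurable.coe_ereal_ennreal (measurable_meetDist (fun x y => ?_) D s t)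
  simp only [shortcutMatrix]
  split_ifs
  exacts [(measurable_pi_apply _).ennreal_ofReal, measurable_const]

/-- Additive errors in the lengths of shortcuts accumulate along the `2 D` steps of a chain. -/
lemma withinError_estimate [DecidableEq V] (w : G.edgeSet → ℝ≥0) {D : ℕ} (hD : ∀ a, lvl a < D)
    {τ B : ℝ} (hτ : 0 ≤ τ) (hB : 2 * D * τ ≤ B) (z : V × V → ℝ) (hz : ∀ i, |z i| ≤ τ) :
    WithinError w B (estimate G lvl D fun i => shortcutVector G lvl w i + z i) := by
  set e := shortcutMatrix G lvl fun x y =>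
    ENNReal.ofReal (shortcutVector G lvl w (x, y) + z (x, y)) with he
  have h1 : ∀ x y, e x y ≤ exactShortcut G lvl w x y + ENNReal.ofReal τ := by
    intro x y
    simp only [he, exactShortcut, shortcutMatrix]
    split_ifs with hS
    · rw [← ENNReal.ofReal_toReal (restrictedDist_ne_top w hS.2),
        ← ENNReal.ofReal_add ENNReal.toReal_nonneg hτ]
      refine ENNReal.ofReal_le_ofReal ?_
      simp only [shortcutVector, if_pos hS]
      linarith [(abs_le.1 (hz (x, y))).2]
    · simp
  have h2 : ∀ x y, exactShortcut G lvl w x y ≤ e x y + ENNReal.ofReal τ := by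
    intro x y
    simp only [he, exactShortcut, shortcutMatrix]
    split_ifs with hS
    · rw [← ENNReal.ofReal_toReal (restrictedDist_ne_top w hS.2)]
      refine (ENNReal.ofReal_le_ofReal ?_).trans ENNReal.ofReal_add_le
      simp only [shortcutVector, if_pos hS]
      linarith [(abs_le.1 (hz (x, y))).1]
    · simp
  have hBnn : 0 ≤ B := le_trans (by positivity) hB
  have hcoe : (2 * (D : ℝ≥0∞) * ENNReal.ofReal τ) ≤ ENNReal.ofReal B := by
    refine le_trans (le_of_eq ?_) (ENNReal.ofReal_le_ofReal hB)
    rw [ENNReal.ofReal_mul (by positivity), ENNReal.ofReal_mul (by norm_num)]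
    simp
  have hBE : ((ENNReal.ofReal B : ℝ≥0∞) : EReal) = (B : EReal) := by
    rw [EReal.coe_ennreal_ofReal, max_eq_left hBnn]
  intro s t
  have h3 := (meetDist_le_add h2 D s t).trans (add_le_add_right hcoe _)
  have h4 := (meetDist_le_add h1 D s t).trans (add_le_add_right hcoe _)
  rw [meetDist_exactShortcut w hD] at h3 h4
  simp only [estimate]
  rw [← hBE, ← EReal.coe_ennreal_add, ← EReal.coe_ennreal_add, EReal.coe_ennreal_le_coe_ennreal_iff,
    EReal.coe_ennreal_le_coe_ennreal_iff]
  exact ⟨h3, h4⟩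

end Shortcuts

/-! ### The private algorithm -/

/-- Adding random noise of a fixed law to a measurable function of the input, followed by
measurable postprocessing, is a Markov kernel. -/
lemma exists_noise_kernel {X ι Y : Type*} [Fintype ι] [MeasurableSpace X] [MeasurableSpace Y]
    (μ : Measure (ι → ℝ)) [IsProbabilityMeasure μ] {u : X → ι → ℝ} (hu : Measurable u)
    {g : (ι → ℝ) → Y} (hg : Measurable g) :
    ∃ M : Kernel X Y, IsMarkovKernel M ∧ ∀ x, M x = μ.map (fun z => g fun i => u x i + z i) := by
  have hg' : Measurable fun y : (ι → ℝ) × (ι → ℝ) => g fun i => y.1 i + y.2 i :=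
    hg.comp (by fun_prop)
  have heq : ∀ x, (μ.map (Prod.mk (u x))).map (fun y => g fun i => y.1 i + y.2 i) =
      μ.map (fun z => g fun i => u x i + z i) := fun x => by
    rw [Measure.map_map hg' (by fun_prop)]
    rfl
  have hmeas : Measurable fun x =>
      (μ.map (Prod.mk (u x))).map fun y => g fun i => y.1 i + y.2 i :=
    (Measure.measurable_map _ hg').comp ((Measurable.map_prodMk_left (ν := μ)).comp hu)
  refine ⟨⟨_, hmeas⟩, ⟨fun x => ?_⟩, heq⟩
  have h : Measurable fun z : ι → ℝ => g fun i => u x i + z i := hg.comp (by fun_prop)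
  change IsProbabilityMeasure ((μ.map (Prod.mk (u x))).map fun y => g fun i => y.1 i + y.2 i)
  rw [heq]
  exact Measure.isProbabilityMeasure_map h.aemeasurable

/-- On at most one vertex the error bound holds trivially, or is required with probability `0`
only. -/
lemma exists_kernel_of_subsingleton {n : ℕ} (hn : n < 2) (G : SimpleGraph (Fin n)) {ε : ℝ} (δ : ℝ)
    (hε : 0 < ε) :
    ∃ M : Kernel (G.edgeSet → ℝ≥0) (Fin n → Fin n → EReal),
      IsMarkovKernel M ∧ IsDifferentiallyPrivate Neighboring ε δ M ∧
      ∀ a : ℝ, 0 < a → ∀ (w : G.edgeSet → ℝ≥0) (B : ℝ),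
        1 - (n : ℝ) ^ (-a) ≤ (M w).real {est | WithinError w B est} := by
  refine ⟨Kernel.const _ (Measure.dirac 0), inferInstance, fun x x' _ T _ => ?_,
    fun a ha w B => ?_⟩
  · simp only [Kernel.const_apply]
    refine le_add_right (le_mul_of_one_le_left (zero_le) ?_)
    rw [ENNReal.one_le_ofReal]
    exact Real.one_le_exp hε.le
  · obtain rfl | rfl : n = 0 ∨ n = 1 := by omega
    · have : {est : Fin 0 → Fin 0 → EReal | WithinError w B est} = Set.univ :=
        Set.eq_univ_of_forall fun est s => s.elim0
      simp [this, Real.zero_rpow (neg_ne_zero.2 ha.ne')]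
    · simp

/-- Every level function with few hubs gives a private algorithm; its error is governed by
the number `D` of levels and the bound `P` on the number of hubs of a vertex. -/
lemma exists_kernel_of_level {n : ℕ} (hn : 2 ≤ n) {G : SimpleGraph (Fin n)} {lvl : Fin n → ℕ}
    {D P : ℕ} (hD : ∀ a, lvl a < D) (hP : ∀ a, {x | HubOf G Set.univ lvl x a}.ncard ≤ P)
    (hP0 : 0 < P) {ε δ : ℝ} (hε : 0 < ε) (hε1 : ε < 1) (hδ : 0 < δ) (hδ1 : δ < 1) :
    ∃ M : Kernel (G.edgeSet → ℝ≥0) (Fin n → Fin n → EReal),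
      IsMarkovKernel M ∧ IsDifferentiallyPrivate Neighboring ε δ M ∧
      ∀ a : ℝ, 0 < a → ∀ (w : G.edgeSet → ℝ≥0) (B : ℝ),
        2 * D * √(32 * (a + 3) * ((Real.log (1 / δ) + 1) * Real.log n) * P ^ 2 / ε ^ 2) ≤ B →
        1 - (n : ℝ) ^ (-a) ≤ (M w).real {est | WithinError w B est} := by
  have hlog : 0 < Real.log (1 / δ) := Real.log_pos (by rw [lt_div_iff₀ hδ]; linarith)
  have hPr : (0 : ℝ) < P := by exact_mod_cast hP0
  have hvpos : 0 < 4 * (Real.log (1 / δ) + 1) * (2 * (P : ℝ)) ^ 2 / ε ^ 2 := by positivity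
  obtain ⟨v, hv⟩ : ∃ v : ℝ≥0, (v : ℝ) = 4 * (Real.log (1 / δ) + 1) * (2 * (P : ℝ)) ^ 2 / ε ^ 2 :=
    ⟨⟨_, hvpos.le⟩, rfl⟩
  have hv0 : v ≠ 0 := by rintro rfl; rw [← hv] at hvpos; simp at hvpos
  set μ := Measure.pi fun _ : Fin n × Fin n => gaussianReal 0 v
  have hgm : Measurable (estimate G lvl D) := measurable_estimate D
  obtain ⟨M, hM, hMw⟩ := exists_noise_kernel μ (measurable_shortcutVector (G := G) (lvl := lvl)) hgm
  have hmeas : ∀ w, Measurable fun z : Fin n × Fin n → ℝ =>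
      estimate G lvl D fun i => shortcutVector G lvl w i + z i :=
    fun w => hgm.comp (by fun_prop)
  refine ⟨M, hM, fun w w' hw T hT => ?_, fun a ha w B hB => ?_⟩
  · rw [hMw, hMw, Measure.map_apply (hmeas w) hT, Measure.map_apply (hmeas w') hT]
    refine gaussian_mechanism (shortcutVector G lvl w) (shortcutVector G lvl w') hε hε1 hδ hδ1
      (Δ := 2 * P) (by positivity) hv ?_ _ (hgm hT)
    refine (sum_shortcutVector_sub_sq_le hP hw).trans ?_
    nlinarith [sq_nonneg (P : ℝ)]
  · have hn1 : (2 : ℝ) ≤ n := by exact_mod_cast hn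
    have hlogn : 0 < Real.log n := Real.log_pos (by linarith)
    set τ := √(32 * (a + 3) * ((Real.log (1 / δ) + 1) * Real.log n) * P ^ 2 / ε ^ 2) with hτ
    have hτ0 : 0 ≤ τ := Real.sqrt_nonneg _
    have hexp : Real.exp (-τ ^ 2 / (2 * v)) = (n : ℝ) ^ (-a) / (n : ℝ) ^ 3 := by
      have h1 : -τ ^ 2 / (2 * v) = Real.log n * (-a - 3) := by
        rw [hτ, Real.sq_sqrt (by positivity), hv]
        field_simp
        ring
      rw [h1, ← Real.rpow_def_of_pos (by linarith), Real.rpow_sub (by linarith)]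
      norm_cast
    have hfail : (Fintype.card (Fin n × Fin n) : ℝ) * (2 * Real.exp (-τ ^ 2 / (2 * v))) ≤
        (n : ℝ) ^ (-a) := by
      rw [hexp, Fintype.card_prod, Fintype.card_fin]
      push_cast
      have hna : 0 ≤ (n : ℝ) ^ (-a) := Real.rpow_nonneg (by linarith) _
      calc (n : ℝ) * n * (2 * ((n : ℝ) ^ (-a) / (n : ℝ) ^ 3)) = (n : ℝ) ^ (-a) * (2 / n) := by
            field_simp
        _ ≤ (n : ℝ) ^ (-a) * 1 := by
            gcongr
            rw [div_le_one (by linarith)]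
            exact hn1
        _ = _ := mul_one _
    calc 1 - (n : ℝ) ^ (-a)
        ≤ 1 - Fintype.card (Fin n × Fin n) * (2 * Real.exp (-τ ^ 2 / (2 * v))) := by linarith
      _ ≤ μ.real {z | ∀ i, |z i| ≤ τ} := gaussian_pi_tail hv0 hτ0
      _ ≤ μ.real ((fun z => estimate G lvl D fun i => shortcutVector G lvl w i + z i) ⁻¹'
            {est | WithinError w B est}) :=
          measureReal_mono fun z hz => withinError_estimate w hD hτ0 hB z hz
      _ ≤ (M w).real {est | WithinError w B est} := by
          rw [hMw]
          exact ENNReal.toReal_mono (measure_ne_top _ _)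
            (Measure.le_map_apply (hmeas w).aemeasurable _)

/-- The error bound of `exists_kernel_of_level` for `D ≤ K log n` levels and `P = D (p + c)`. -/
lemma error_bound_le {K a p c D ε δ n : ℝ} (ha : 0 < a) (hp : 1 ≤ p)
    (hc : 0 ≤ c) (hD0 : 0 ≤ D) (hD : D ≤ K * Real.log n) (hε : 0 < ε) (hδ : 0 < δ) (hδ1 : δ < 1)
    (hn : 2 ≤ n) :
    2 * D * √(32 * (a + 3) * ((Real.log (1 / δ) + 1) * Real.log n) * (D * (p + c)) ^ 2 / ε ^ 2) ≤
      4 * K ^ 2 * (1 + c) * √(32 * (a + 3)) * (p * Real.log n ^ 2 * Real.log (n / δ) / ε) := by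
  have hlog2 : 1 / 2 < Real.log 2 := by linarith [Real.log_two_gt_d9]
  have hlogn : Real.log 2 ≤ Real.log n := Real.log_le_log (by norm_num) hn
  have hlogδ : 0 < Real.log (1 / δ) := Real.log_pos (by rw [lt_div_iff₀ hδ]; linarith)
  have hsum : Real.log (n / δ) = Real.log n + Real.log (1 / δ) := by
    rw [div_eq_mul_one_div, Real.log_mul (by linarith) (by positivity)]
  set l := Real.log n
  set d := Real.log (1 / δ)
  rw [hsum]
  have hl : 0 < l := by linarith
  have hpc : p + c ≤ (1 + c) * p := by nlinarith
  have hroot : √(32 * (a + 3) * ((d + 1) * l) * (D * (p + c)) ^ 2 / ε ^ 2) ≤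
      √(32 * (a + 3)) * (2 * (l + d)) * (D * (p + c)) / ε := by
    refine Real.sqrt_le_iff.2 ⟨by positivity, ?_⟩
    have h1 : (d + 1) * l ≤ (2 * (l + d)) ^ 2 := by nlinarith
    calc 32 * (a + 3) * ((d + 1) * l) * (D * (p + c)) ^ 2 / ε ^ 2
        ≤ 32 * (a + 3) * (2 * (l + d)) ^ 2 * (D * (p + c)) ^ 2 / ε ^ 2 := by gcongr
      _ = (√(32 * (a + 3)) * (2 * (l + d)) * (D * (p + c)) / ε) ^ 2 := by
          rw [div_pow, mul_pow (_ * _), mul_pow √_, Real.sq_sqrt (by positivity)]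
  have hK : 0 ≤ K * l := hD0.trans hD
  calc 2 * D * √(32 * (a + 3) * ((d + 1) * l) * (D * (p + c)) ^ 2 / ε ^ 2)
      ≤ 2 * D * (√(32 * (a + 3)) * (2 * (l + d)) * (D * (p + c)) / ε) := by gcongr
    _ ≤ 2 * (K * l) * (√(32 * (a + 3)) * (2 * (l + d)) * ((K * l) * ((1 + c) * p)) / ε) := by
        gcongr
    _ = _ := by ring

end PrivateAPSD

theorem theorem3p1 (q q' : ℝ) (hq : 1 / 2 ≤ q) (hqq' : q ≤ q') (hq' : q' < 1) (c : ℕ) :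
    ∃ C : ℝ → ℝ, ∀ (ε δ : ℝ), 0 < ε → ε < 1 → 0 < δ → δ < 1 →
      ∀ (n p : ℕ), 1 ≤ p → ∀ G : SimpleGraph (Fin n), PrivateAPSD.RecSeparable c p q q' G →
        ∃ M : Kernel (G.edgeSet → ℝ≥0) (Fin n → Fin n → EReal),
          IsMarkovKernel M ∧
          PrivateAPSD.IsDifferentiallyPrivate PrivateAPSD.Neighboring ε δ M ∧
          ∀ a : ℝ, 0 < a → ∀ w : G.edgeSet → ℝ≥0,
            1 - (n : ℝ) ^ (-a) ≤
              (M w).real {est | PrivateAPSD.WithinError w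
                (C a * (p * Real.log n ^ 2 * Real.log (n / δ) / ε)) est} := by
  have hq0 : 0 < q := by linarith
  have hq1 : q < 1 := by linarith
  have hβ : 0 < Real.log (1 / q) := Real.log_pos (by rw [lt_div_iff₀ hq0]; linarith)
  have hlog2 : 0 < Real.log 2 := Real.log_pos (by norm_num)
  set K := 1 / Real.log (1 / q) + 1 / Real.log 2 with hK
  refine ⟨fun a => 4 * K ^ 2 * (1 + (c : ℝ)) * √(32 * (a + 3)), ?_⟩
  intro ε δ hε hε1 hδ hδ1 n p hp G hG
  rcases lt_or_ge n 2 with hn | hn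
  · obtain ⟨M, hM, hdp, hacc⟩ := PrivateAPSD.exists_kernel_of_subsingleton hn G δ hε
    exact ⟨M, hM, hdp, fun a ha w => hacc a ha w _⟩
  have hn1 : (2 : ℝ) ≤ n := by exact_mod_cast hn
  have hlogn : Real.log 2 ≤ Real.log n := Real.log_le_log (by norm_num) hn1
  -- With this many levels, sizes that shrink by the factor `q` per level fall below `1`.
  set D := ⌊Real.log n / Real.log (1 / q)⌋₊ + 1 with hDdef
  have hDK : (D : ℝ) ≤ K * Real.log n := by
    have h1 : (D : ℝ) ≤ Real.log n / Real.log (1 / q) + 1 := by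
      rw [hDdef]
      push_cast
      gcongr
      exact Nat.floor_le (div_nonneg (hlog2.le.trans hlogn) hβ.le)
    have h2 : 1 ≤ Real.log n / Real.log 2 := by rwa [one_le_div hlog2]
    calc (D : ℝ) ≤ Real.log n / Real.log (1 / q) + Real.log n / Real.log 2 := by linarith
      _ = K * Real.log n := by rw [hK]; ring
  have hqD : q ^ D * ((Set.univ : Set (Fin n)).ncard : ℝ) < 1 := by
    rw [Set.ncard_univ, Nat.card_eq_fintype_card, Fintype.card_fin]
    have h1 : Real.log n < D * Real.log (1 / q) := by
      rw [← div_lt_iff₀ hβ, hDdef]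
      push_cast
      exact Nat.lt_floor_add_one _
    rw [one_div, Real.log_inv] at h1
    rw [← Real.log_neg_iff (by positivity), Real.log_mul (by positivity) (by positivity),
      Real.log_pow]
    linarith
  have htop : (⊤ : G.Subgraph).induce Set.univ = ⊤ := SimpleGraph.Subgraph.induce_self_verts
  obtain ⟨lvl, hD, hP⟩ := PrivateAPSD.exists_level (p := p) (c := c) (q' := q') hq0 hq1 D Set.univ
    (by rw [htop]; exact hG) hqD
  obtain ⟨M, hM, hdp, hacc⟩ := PrivateAPSD.exists_kernel_of_level (G := G) (P := D * (p + c)) hn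
    (fun a => hD a trivial) (fun a => PrivateAPSD.ncard_hubs_le hD hP a trivial)
    (by positivity) hε hε1 hδ hδ1
  refine ⟨M, hM, hdp, fun a ha w => hacc a ha w _ ?_⟩
  push_cast
  exact PrivateAPSD.error_bound_le ha (by exact_mod_cast hp) c.cast_nonneg D.cast_nonneg hDK hε hδ
    hδ1 hn1
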